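/- **The cooperative network creation game.** Let $G=(V,E)$ be a finite connected simple graph (the *host graph*) with $n$ vertices, one player per vertex, and let $\alpha>0$ be the price of a link. A joint strategy $s$ assigns to every player $i\in V$ and every host edge $e\in E$ an offer $s(i,e)\ge 0$. The edge $e$ is *built* if $\sum_{i\in V}s(i,e)\ge\alpha$; let $E_s$ be the set of built edges and $G_s=(V,E_s)$. For $e\in E_s$ player $i$ pays $p_s(i,e)=\alpha\,s(i,e)/\sum_{k\in V}s(k,e)$, and $p_s(i,e)=0$ for $e\notin E_s$. The cost of player $i$ and the total cost are $$c_i(s)=\sum_{e\in E_s}p_s(i,e)+\sum_{j\in V}d_{G_s}(i,j),\qquad c(s)=\alpha\,|E_s|+\sum_{i\in V}\sum_{j\in V}d_{G_s}(i,j),$$ where $d_{G_s}(i,j)=\infty$ if $i$ and $j$ lie in different components of $G_s$. A joint strategy $s$ is a *collaborative equilibrium* if $\sum_{i}s(i,e)\in\{0,\alpha\}$ for every $e\in E$, and for every $e\in E$, every coalition $C\subseteq V$ and every joint strategy $s'$ that differs from $s$ only in values $s'(i,e)$ with $i\in C$ and for which the payments change ($p_{s'}\ne p_s$), some player $i\in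 C$ has $c_i(s')>c_i(s)$. The *price of anarchy* $\mathrm{PoA}(G,\alpha)$ is the maximum of $c(s)$ over collaborative equilibria $s$, divided by the minimum of $c(s)$ over all joint strategies $s$. **Theorem.** The price of anarchy of the cooperative game on general host graphs is $\Omega\bigl(\min\{\sqrt{\alpha/n},\,n^2/\alpha\}\bigr)$. That is, there is an absolute constant $c>0$ such that for every integer $n\ge 2$ and every real $\alpha>0$ there is a connected host graph $G$ on $n$ vertices with $$\mathrm{PoA}(G,\alpha)\;\ge\;c\cdot\min\left\{\sqrt{\frac{\alpha}{n}},\ \frac{n^2}{\alpha}\right\}.$$ -/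

import Mathlib

open scoped NNReal ENNReal

namespace CooperativeGame

/-- A joint strategy on the host graph `G`: `s i e` is the (nonnegative) amount that player `i`
offers to pay for the host edge `e`. -/
abbrev JointStrategy {V : Type*} (G : SimpleGraph V) : Type _ := V → G.edgeSet → ℝ≥0

/-- The total amount offered for the host edge `e`. -/
def offered {V : Type*} [Fintype V] {G : SimpleGraph V} (s : JointStrategy G) (e : G.edgeSet) :
    ℝ≥0 :=
  ∑ i, s i e

open Classical in
/-- The edge set `E_s`: host edges whose total offer is at least `α`. -/
noncomputable def builtEdges {V : Type*} [Fintype V] {G : SimpleGraph V} (α : ℝ≥0)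
    (s : JointStrategy G) : Finset G.edgeSet :=
  {e | α ≤ offered s e}

/-- The created network `G_s`, a spanning subgraph of the host graph. -/
def network {V : Type*} [Fintype V] {G : SimpleGraph V} (α : ℝ≥0) (s : JointStrategy G) :
    SimpleGraph V :=
  SimpleGraph.fromEdgeSet {e | ∃ h : e ∈ G.edgeSet, (⟨e, h⟩ : G.edgeSet) ∈ builtEdges α s}

open Classical in
/-- What player `i` actually pays for `e`: nothing if `e` is not built; otherwise the offers are
uniformly scaled so as to sum to exactly `α` (if they already sum to `α > 0`, this is `s i e`). -/
noncomputable def payment {V : Type*} [Fintype V] {G : SimpleGraph V} (α : ℝ≥0)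
    (s : JointStrategy G) (i : V) (e : G.edgeSet) : ℝ≥0 :=
  if e ∈ builtEdges α s then α * s i e / offered s e else 0

/-- The cost of player `i`: payments for built edges plus the sum of the distances in the created
network. Distances between different components are `∞`. -/
noncomputable def playerCost {V : Type*} [Fintype V] {G : SimpleGraph V} (α : ℝ≥0)
    (s : JointStrategy G) (i : V) : ℝ≥0∞ :=
  ∑ e ∈ builtEdges α s, (payment α s i e : ℝ≥0∞) +
    ∑ j, (((network α s).edist i j : ℕ∞) : ℝ≥0∞)

/-- The total cost `α |E_s| + ∑ i, ∑ j, d(i, j)` of a joint strategy. -/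
noncomputable def totalCost {V : Type*} [Fintype V] {G : SimpleGraph V} (α : ℝ≥0)
    (s : JointStrategy G) : ℝ≥0∞ :=
  (α : ℝ≥0∞) * ((builtEdges α s).card : ℝ≥0∞) +
    ∑ i, ∑ j, (((network α s).edist i j : ℕ∞) : ℝ≥0∞)

/-- Collaborative equilibrium: the offers for every host edge sum to `0` or `α`, and whenever a
coalition `C` changes its offers on a single host edge `e` (so that the payments really change),
some member of `C` is strictly worse off. -/
def IsCollaborativeEquilibrium {V : Type*} [Fintype V] {G : SimpleGraph V} (α : ℝ≥0)
    (s : JointStrategy G) : Prop :=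
  (∀ e, offered s e = 0 ∨ offered s e = α) ∧
  ∀ (e : G.edgeSet) (C : Set V) (s' : JointStrategy G),
    (∀ i f, s' i f ≠ s i f → i ∈ C ∧ f = e) →
    payment α s' ≠ payment α s →
    ∃ i ∈ C, playerCost α s i < playerCost α s' i

/-- The price of anarchy on the host graph `G`: the maximum total cost of a collaborative
equilibrium over the minimum total cost of any joint strategy. (Total costs take finitely many
values, since they depend only on the set of built edges.) -/
noncomputable def priceOfAnarchy {V : Type*} [Fintype V] (α : ℝ≥0) (G : SimpleGraph V) : ℝ≥0∞ :=
  (⨆ (s : JointStrategy G) (_ : IsCollaborativeEquilibrium α s), totalCost α s) /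
    (⨅ s : JointStrategy G, totalCost α s)

end CooperativeGame

/-! The comb is a tree: a spine with a tooth of `k` vertices hanging at every `k`-th spine vertex.
The host graph also joins the tip of each tooth to the branching vertex of its own block and to that
of the next block. Through the tips, the host graph crosses a block of the spine in two steps
instead of `k`. Its distance sum is thus O(n³/k) when `k ^ 2` is O(n), while that of the comb is of
order n³.

A single chord gains almost nothing. The long cycle that it closes can be folded back into the comb
by moving only the at most `k` vertices of one tooth, each by O(k), so the distance sum drops by at
most `8 * n * k ^ 2` (`distSum_comb_le`). Summing the cost inequalities over all players shows that
a spanning tree is an equilibrium as soon as every single host edge gains less than `α`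
(`isCollaborativeEquilibrium_evenOffers`). Hence the comb is an equilibrium when `α > 8 * n * k ^
2`.

Building the whole host graph costs at most O(αn + n³/k), so the ratio is of order min(k, n²/α), and
`k` may be taken of order √(α/n). -/

namespace CooperativeGame

/-! ### Spanning trees as collaborative equilibria. -/

section Equilibrium

variable {V : Type*}

/-- The sum of the distances over all ordered pairs of vertices. -/
noncomputable def distSum [Fintype V] (H : SimpleGraph V) : ℝ≥0∞ :=
  ∑ x, ∑ y, ((H.edist x y : ℕ∞) : ℝ≥0∞)

/-- Every player offers the same share of the price of each edge of `T`. -/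
noncomputable def evenOffers [Fintype V] (G T : SimpleGraph V) (α : ℝ≥0) : JointStrategy G :=
  open Classical in fun _ e => if (e : Sym2 V) ∈ T.edgeSet then α / Fintype.card V else 0

variable [Fintype V] {G T : SimpleGraph V} {α : ℝ≥0}

lemma mem_builtEdges {s : JointStrategy G} {e : G.edgeSet} :
    e ∈ builtEdges α s ↔ α ≤ offered s e := by
  simp [builtEdges]

lemma network_adj {s : JointStrategy G} {x y : V} :
    (network α s).Adj x y ↔ ∃ h : s(x, y) ∈ G.edgeSet, α ≤ offered s ⟨s(x, y), h⟩ := by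
  simp only [network, SimpleGraph.fromEdgeSet_adj, Set.mem_ofPred_eq, mem_builtEdges]
  exact ⟨fun h => h.1, fun h => ⟨h, (SimpleGraph.mem_edgeSet G |>.1 h.1).ne⟩⟩

lemma offered_evenOffers_of_mem [Nonempty V] {e : G.edgeSet} (he : (e : Sym2 V) ∈ T.edgeSet) :
    offered (evenOffers G T α) e = α := by
  simp only [offered, evenOffers, he, if_true, Finset.sum_const, Finset.card_univ, nsmul_eq_mul]
  have : (Fintype.card V : ℝ≥0) ≠ 0 := by exact_mod_cast Fintype.card_ne_zero
  field_simp

lemma offered_evenOffers_of_notMem {e : G.edgeSet} (he : (e : Sym2 V) ∉ T.edgeSet) :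
    offered (evenOffers G T α) e = 0 := by
  simp [offered, evenOffers, he]

lemma mem_builtEdges_evenOffers [Nonempty V] (hα : 0 < α) {e : G.edgeSet} :
    e ∈ builtEdges α (evenOffers G T α) ↔ (e : Sym2 V) ∈ T.edgeSet := by
  rw [mem_builtEdges]
  by_cases he : (e : Sym2 V) ∈ T.edgeSet
  · simp [offered_evenOffers_of_mem he, he]
  · simp [offered_evenOffers_of_notMem he, he, hα.ne']

lemma network_evenOffers [Nonempty V] (hα : 0 < α) (hTG : T ≤ G) :
    network α (evenOffers G T α) = T := by
  ext x y
  rw [network_adj]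
  constructor
  · rintro ⟨h, h'⟩
    exact (mem_builtEdges_evenOffers hα).1 (mem_builtEdges.2 h')
  · intro h
    exact ⟨hTG h, mem_builtEdges.1 ((mem_builtEdges_evenOffers (T := T) hα).2 h)⟩

lemma sum_payment {s : JointStrategy G} {e : G.edgeSet} (hα : 0 < α)
    (he : e ∈ builtEdges α s) : ∑ i, payment α s i e = α := by
  have h : offered s e ≠ 0 := (hα.trans_le (mem_builtEdges.1 he)).ne'
  simp only [payment, he, if_true]
  rw [← Finset.sum_div, ← Finset.mul_sum]
  change α * offered s e / offered s e = α
  field_simp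

lemma playerCost_eq_sum [Fintype G.edgeSet] (s : JointStrategy G) (i : V) :
    playerCost α s i = ∑ e, (payment α s i e : ℝ≥0∞) +
      ∑ j, (((network α s).edist i j : ℕ∞) : ℝ≥0∞) := by
  classical
  unfold playerCost
  congr 1
  apply Finset.sum_subset (Finset.subset_univ _)
  intro e _ he
  simp [payment, he]

lemma sum_edist_ne_top {H : SimpleGraph V} (hH : H.Connected) (i : V) :
    ∑ j, ((H.edist i j : ℕ∞) : ℝ≥0∞) ≠ ⊤ := by
  simp only [ne_eq, ENNReal.sum_eq_top, not_exists, not_and, ENat.toENNReal_eq_top]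
  intro j _
  exact SimpleGraph.edist_ne_top_iff_reachable.2 (hH i j)

lemma playerCost_ne_top {s : JointStrategy G} (hs : (network α s).Connected) (i : V) :
    playerCost α s i ≠ ⊤ := by
  classical
  rw [playerCost_eq_sum]
  simp [ENNReal.add_eq_top, sum_edist_ne_top hs]

lemma playerCost_eq_top {s : JointStrategy G} (hs : ¬ (network α s).Connected) (i : V) :
    playerCost α s i = ⊤ := by
  classical
  have : ∃ j, ¬ (network α s).Reachable i j := by
    by_contra! h
    exact hs ((SimpleGraph.connected_iff_exists_forall_reachable _).2 ⟨i, h⟩)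
  obtain ⟨j, hj⟩ := this
  rw [playerCost_eq_sum, ENNReal.add_eq_top]
  right
  rw [ENNReal.sum_eq_top]
  exact ⟨j, Finset.mem_univ _, by simp [SimpleGraph.edist_eq_top_of_not_reachable hj]⟩

lemma totalCost_eq (s : JointStrategy G) :
    totalCost α s = α * ((builtEdges α s).card : ℝ≥0∞) + distSum (network α s) := rfl

/-- If only offers for `e` change, the cost of a player changes by the change of the payment for
`e` and of the distances. -/
lemma payment_add_le_of_playerCost_le {s s' : JointStrategy G} {e : G.edgeSet} {i : V}
    (hpay : ∀ f ≠ e, payment α s' i f = payment α s i f)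
    (h : playerCost α s' i ≤ playerCost α s i) :
    (payment α s' i e : ℝ≥0∞) + ∑ j, (((network α s').edist i j : ℕ∞) : ℝ≥0∞) ≤
      payment α s i e + ∑ j, (((network α s).edist i j : ℕ∞) : ℝ≥0∞) := by
  classical
  rw [playerCost_eq_sum, playerCost_eq_sum, ← Finset.sum_erase_add _ _ (Finset.mem_univ e),
    ← Finset.sum_erase_add _ _ (Finset.mem_univ e)] at h
  have h' : ∑ f ∈ Finset.univ.erase e, (payment α s' i f : ℝ≥0∞) =
      ∑ f ∈ Finset.univ.erase e, (payment α s i f : ℝ≥0∞) :=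
    Finset.sum_congr rfl fun f hf => by rw [hpay f (Finset.ne_of_mem_erase hf)]
  rw [h', add_assoc, add_assoc] at h
  refine (ENNReal.add_le_add_iff_left ?_).1 h
  simp

set_option maxHeartbeats 1000000 in
/-- A spanning tree of the host graph is an equilibrium network if no single additional host edge
reduces the sum of all distances by `α` or more. -/
theorem isCollaborativeEquilibrium_evenOffers [Nonempty V] (hα : 0 < α) (hTG : T ≤ G)
    (hT : T.IsTree)
    (hadd : ∀ x y, G.Adj x y → ¬ T.Adj x y →
      distSum T < distSum (T ⊔ SimpleGraph.edge x y) + α) :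
    IsCollaborativeEquilibrium α (evenOffers G T α) := by
  classical
  set s := evenOffers G T α with hs
  have hnet : network α s = T := network_evenOffers hα hTG
  refine ⟨fun e => ?_, fun e C s' hdiff hpay => ?_⟩
  · by_cases he : (e : Sym2 V) ∈ T.edgeSet
    · exact Or.inr (offered_evenOffers_of_mem he)
    · exact Or.inl (offered_evenOffers_of_notMem he)
  by_contra! hC
  have hoff : ∀ f ≠ e, offered s' f = offered s f := fun f hf =>
    Finset.sum_congr rfl fun i _ => by
      by_contra h; exact hf (hdiff i f h).2
  have hpayf : ∀ i, ∀ f ≠ e, payment α s' i f = payment α s i f := fun i f hf => by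
    have h1 : s' i f = s i f := by by_contra h; exact hf (hdiff i f h).2
    simp only [payment, mem_builtEdges, hoff f hf, h1]
  have hpaye : ∃ i, payment α s' i e ≠ payment α s i e := by
    by_contra! h
    refine hpay (funext fun i => funext fun f => ?_)
    by_cases hf : f = e
    · rw [hf, h]
    · exact hpayf i f hf
  have hCne : ∃ i, i ∈ C := by
    by_contra! h
    refine hpay ?_
    have : s' = s := by
      funext i f
      by_contra h'
      exact h i (hdiff i f h').1
    rw [this]
  have hnot : ∀ i ∉ C, s' i e = s i e := fun i hi => by
    by_contra h; exact hi (hdiff i e h).1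
  obtain ⟨e, heG⟩ := e
  induction e with | _ x y =>
  have hxy : G.Adj x y := heG
  have hsub : ∀ a b, s(a, b) ≠ s(x, y) → ((network α s').Adj a b ↔ T.Adj a b) := by
    intro a b hab
    rw [← hnet, network_adj, network_adj]
    refine exists_congr fun h => ?_
    rw [hoff _ (by simpa [Subtype.ext_iff] using hab)]
  by_cases hb : (⟨s(x, y), heG⟩ : G.edgeSet) ∈ builtEdges α s'
  · -- the edge is built under the deviation
    have hbadj : (network α s').Adj x y := network_adj.2 ⟨heG, mem_builtEdges.1 hb⟩
    have hTs' : T ≤ network α s' := by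
      intro a b hab
      by_cases h : s(a, b) = s(x, y)
      · rw [← SimpleGraph.mem_edgeSet, h]; exact hbadj
      · exact (hsub a b h).2 hab
    have hdist : ∀ i, ∑ j, (((network α s').edist i j : ℕ∞) : ℝ≥0∞) ≤
        ∑ j, ((T.edist i j : ℕ∞) : ℝ≥0∞) := fun i =>
      Finset.sum_le_sum fun j _ => ENat.toENNReal_le.2 (SimpleGraph.edist_anti hTs')
    -- The inequality holds for all players, not only for the coalition, and so can be summed over
    -- `V`.
    have hle : ∀ i, (payment α s' i ⟨s(x, y), heG⟩ : ℝ≥0∞) +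
        ∑ j, (((network α s').edist i j : ℕ∞) : ℝ≥0∞) ≤
        payment α s i ⟨s(x, y), heG⟩ + ∑ j, ((T.edist i j : ℕ∞) : ℝ≥0∞) := by
      intro i
      by_cases hi : i ∈ C
      · have := payment_add_le_of_playerCost_le (hpayf i) (hC i hi)
        rwa [hnet] at this
      -- Outsiders keep their offer while the total is at least `α`, so scaling cannot raise their
      -- payment.
      · refine add_le_add ?_ (hdist i)
        rw [ENNReal.coe_le_coe]
        simp only [payment, hb, if_true, hnot i hi]
        by_cases he : s(x, y) ∈ T.edgeSet
        · have ho : offered s ⟨s(x, y), heG⟩ = α := offered_evenOffers_of_mem he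
          rw [if_pos (mem_builtEdges.2 ho.ge), ho]
          have := mem_builtEdges.1 hb
          gcongr
        · have : s i ⟨s(x, y), heG⟩ = 0 := by simp [hs, evenOffers, he]
          simp [this]
    by_cases he : T.Adj x y
    · -- only the payments for an edge of the tree change
      have hbs : (⟨s(x, y), heG⟩ : G.edgeSet) ∈ builtEdges α s :=
        (mem_builtEdges_evenOffers hα).2 he
      have hnet' : network α s' = T := by
        refine le_antisymm (fun a b hab => ?_) hTs'
        by_cases h : s(a, b) = s(x, y)
        · rw [← SimpleGraph.mem_edgeSet, h]; exact he
        · exact (hsub a b h).1 hab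
      -- No payment rises, yet both families of payments sum to `α`, so none changes.
      have hle' : ∀ i ∈ Finset.univ, payment α s' i ⟨s(x, y), heG⟩ ≤
          payment α s i ⟨s(x, y), heG⟩ := by
        intro i _
        have := hle i
        rw [hnet', ENNReal.add_le_add_iff_right (sum_edist_ne_top hT.1 i)] at this
        exact_mod_cast this
      obtain ⟨i, hi⟩ := hpaye
      refine hi ((Finset.sum_eq_sum_iff_of_le hle').1 ?_ i (Finset.mem_univ i))
      rw [sum_payment hα hb, sum_payment hα hbs]
    · -- a new edge is built
      have hbs : (⟨s(x, y), heG⟩ : G.edgeSet) ∉ builtEdges α s := fun h =>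
        he ((mem_builtEdges_evenOffers hα).1 h)
      have hnet' : network α s' = T ⊔ SimpleGraph.edge x y := by
        ext a b
        by_cases h : s(a, b) = s(x, y)
        · have h1 : (network α s').Adj a b := by
            rw [← SimpleGraph.mem_edgeSet, h]; exact hbadj
          have h2 : (T ⊔ SimpleGraph.edge x y).Adj a b := by
            refine Or.inr ?_
            rw [← SimpleGraph.mem_edgeSet, h, SimpleGraph.mem_edgeSet,
              SimpleGraph.edge_adj]
            exact ⟨by simp, hxy.ne⟩
          exact iff_of_true h1 h2
        · rw [hsub a b h, SimpleGraph.sup_adj, SimpleGraph.edge_adj]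
          simp only [Sym2.eq, Sym2.rel_iff', Prod.mk.injEq, Prod.swap_prod_mk] at h
          tauto
      -- Summed over all players, the payments for the new edge give `α`, contradicting `hadd`.
      have := Finset.sum_le_sum fun i (_ : i ∈ Finset.univ) => hle i
      rw [Finset.sum_add_distrib, Finset.sum_add_distrib, ← ENNReal.ofNNReal_finsetSum,
        sum_payment hα hb, hnet'] at this
      simp only [payment, hbs, if_false, ENNReal.coe_zero, Finset.sum_const_zero, zero_add] at this
      refine (hadd x y hxy he).not_ge ?_
      rw [add_comm]
      exact this
  · -- the edge is not built under the deviation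
    by_cases he : T.Adj x y
    · have hle : network α s' ≤ T.deleteEdges {s(x, y)} := by
        intro a b hab
        have h : s(a, b) ≠ s(x, y) := by
          intro h
          obtain ⟨h1, h2⟩ := network_adj.1 hab
          apply hb
          rw [mem_builtEdges]
          simpa only [h] using h2
        rw [SimpleGraph.deleteEdges_adj]
        exact ⟨(hsub a b h).1 hab, h⟩
      -- Every edge of a tree is a bridge, so dropping one makes every player's cost infinite.
      have hdis : ¬ (network α s').Connected := fun hc =>
        (SimpleGraph.isBridge_iff.1 (SimpleGraph.isAcyclic_iff_forall_isBridge.1 hT.2 he)) <|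
          (hc x y).mono (by simpa [SimpleGraph.deleteEdges] using hle)
      obtain ⟨i, hi⟩ := hCne
      have h1 := hC i hi
      rw [playerCost_eq_top hdis, top_le_iff] at h1
      exact playerCost_ne_top (by rw [hnet]; exact hT.1) i h1
    · obtain ⟨i, hi⟩ := hpaye
      apply hi
      have hbs : (⟨s(x, y), heG⟩ : G.edgeSet) ∉ builtEdges α s := fun h =>
        he ((mem_builtEdges_evenOffers hα).1 h)
      simp [payment, hb, hbs]

end Equilibrium

/-! ### Comparing graph distances. -/

section Distances

variable {V : Type*}

/-- The distance of a graph is the largest pseudometric in which adjacent vertices have distance at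
most one. -/
lemma le_edist_of_adj_le_one {H : SimpleGraph V} {D : V → V → ℕ∞} (h0 : ∀ x, D x x = 0)
    (htri : ∀ x y z, D x z ≤ D x y + D y z) (h1 : ∀ x y, H.Adj x y → D x y ≤ 1) (x y : V) :
    D x y ≤ H.edist x y := by
  refine le_iInf fun w => ?_
  induction w with
  | nil => simp [h0]
  | @cons a b c hab w ih =>
    calc D a c ≤ D a b + D b c := htri a b c
      _ ≤ 1 + w.length := add_le_add (h1 a b hab) ih
      _ = _ := by rw [SimpleGraph.Walk.length_cons]; push_cast; rw [add_comm]

/-- If a map folds `H` into `T` and moves only the vertices of `S`, by at most `D` each, then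
distances in `T` are not much larger than those in `H`. -/
lemma distSum_le_of_fold [Fintype V] {T H : SimpleGraph V} (φ : V → V) (S : Finset V) (D : ℕ)
    (hφ : ∀ x y, H.Adj x y → T.edist (φ x) (φ y) ≤ 1) (hfix : ∀ x ∉ S, φ x = x)
    (hmove : ∀ x, T.edist x (φ x) ≤ D) :
    distSum T ≤ distSum H + ((2 * Fintype.card V * S.card * D : ℕ) : ℝ≥0∞) := by
  classical
  set c : V → ℕ := fun x => if x ∈ S then D else 0 with hc
  have hmove' : ∀ x, T.edist x (φ x) ≤ c x := by
    intro x
    by_cases hx : x ∈ S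
    · simpa [hc, hx] using hmove x
    · simp [hfix x hx]
  have hpair : ∀ x y, T.edist x y ≤ H.edist x y + ((c x + c y : ℕ) : ℕ∞) := by
    intro x y
    -- The metric of `T`, pulled back along `φ`, gives edges of `H` length at most one.
    have hle : T.edist (φ x) (φ y) ≤ H.edist x y :=
      le_edist_of_adj_le_one (D := fun x y => T.edist (φ x) (φ y)) (fun _ => by simp)
        (fun _ _ _ => SimpleGraph.edist_triangle) hφ x y
    calc T.edist x y ≤ T.edist x (φ x) + (T.edist (φ x) (φ y) + T.edist (φ y) y) :=
          SimpleGraph.edist_triangle.trans (add_le_add le_rfl SimpleGraph.edist_triangle)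
      _ ≤ c x + (H.edist x y + c y) :=
          add_le_add (hmove' x) (add_le_add hle (SimpleGraph.edist_comm.trans_le (hmove' y)))
      _ = _ := by push_cast; ring
  have hsum : ∑ x, c x = S.card * D := by simp [hc]
  calc distSum T ≤ ∑ x, ∑ y, (((H.edist x y : ℕ∞) : ℝ≥0∞) + ((c x + c y : ℕ) : ℝ≥0∞)) := by
        refine Finset.sum_le_sum fun x _ => Finset.sum_le_sum fun y _ => ?_
        have := ENat.toENNReal_le.2 (hpair x y)
        rwa [ENat.toENNReal_add, ENat.toENNReal_coe] at this
    _ = distSum H + ((∑ x, ∑ y, (c x + c y) : ℕ) : ℝ≥0∞) := by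
        simp only [Finset.sum_add_distrib, distSum]
        push_cast
        simp only [Finset.sum_add_distrib]
    _ = _ := by
        congr 2
        simp only [Finset.sum_add_distrib, Finset.sum_const, Finset.card_univ, smul_eq_mul, hsum,
          ← Finset.mul_sum]
        ring

/-- A graph from a functional relation has at most as many edges as the relation has sources. -/
lemma ncard_edgeSet_fromRel_le [Finite V] {R : V → V → Prop}
    (hR : ∀ x y z, R x y → R x z → y = z) (S : Set V) (hS : ∀ x y, R x y → x ∈ S) :
    (SimpleGraph.fromRel R).edgeSet.ncard ≤ S.ncard := by
  classical
  let f : V → Sym2 V := fun x => if h : ∃ y, R x y then s(x, h.choose) else s(x, x)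
  have hf : ∀ x y, R x y → f x = s(x, y) := fun x y h => by
    have hex : ∃ y, R x y := ⟨y, h⟩
    simp only [f, hex, dif_pos]
    rw [hR x _ _ hex.choose_spec h]
  refine (Set.ncard_le_ncard (t := f '' S) ?_ (Set.toFinite _)).trans
    (Set.ncard_image_le (Set.toFinite _))
  intro e
  induction e with | _ x y =>
  rw [SimpleGraph.mem_edgeSet, SimpleGraph.fromRel_adj]
  rintro ⟨-, h | h⟩
  · exact ⟨x, hS x y h, hf x y h⟩
  · exact ⟨y, hS y x h, (hf y x h).trans Sym2.eq_swap⟩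

end Distances

/-! ### The comb and its host graph. -/

section Comb

variable {n k : ℕ}

/-- The vertices are cut into blocks of length `2 * k`; `blk k x` is the block of `x`. -/
def blk (k : ℕ) (x : Fin n) : ℕ := x / (2 * k)

/-- The place of `x` in its block: the first `k` places are a piece of the spine of the comb, the
last `k` places are a tooth. -/
def idx (k : ℕ) (x : Fin n) : ℕ := x % (2 * k)

/-- `y` is the parent of `x` in the comb. -/
def IsParent (k : ℕ) (x y : Fin n) : Prop :=
  (idx k x = 0 ∧ blk k y + 1 = blk k x ∧ idx k y + 1 = k) ∨
  (idx k x = k ∧ blk k y = blk k x ∧ idx k y = 0) ∨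
  (idx k x ≠ 0 ∧ idx k x ≠ k ∧ blk k y = blk k x ∧ idx k y + 1 = idx k x)

/-- `x` is the tip of a tooth and `y` the first vertex of the same block. -/
def IsToothChord (k : ℕ) (x y : Fin n) : Prop :=
  idx k x + 1 = 2 * k ∧ blk k y = blk k x ∧ idx k y = 0

/-- `x` is the tip of a tooth and `y` the first vertex of the next block. -/
def IsBridgeChord (k : ℕ) (x y : Fin n) : Prop :=
  idx k x + 1 = 2 * k ∧ blk k y = blk k x + 1 ∧ idx k y = 0

/-- The comb: a spine with a tooth of length `k` at every `k`-th vertex. -/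
def comb (k n : ℕ) : SimpleGraph (Fin n) := SimpleGraph.fromRel (IsParent k)

/-- The comb with the tip of each tooth joined to the two nearest branching vertices. -/
def combHost (k n : ℕ) : SimpleGraph (Fin n) :=
  comb k n ⊔ (SimpleGraph.fromRel (IsToothChord k) ⊔ SimpleGraph.fromRel (IsBridgeChord k))

lemma val_eq (k : ℕ) (x : Fin n) : (x : ℕ) = 2 * k * blk k x + idx k x :=
  (Nat.div_add_mod _ _).symm

lemma idx_lt (hk : 0 < k) (x : Fin n) : idx k x < 2 * k := Nat.mod_lt _ (by omega)

lemma eq_of_blk_idx {x y : Fin n} (h1 : blk k x = blk k y) (h2 : idx k x = idx k y) : x = y := by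
  rw [Fin.ext_iff, val_eq k x, val_eq k y, h1, h2]

/-- Only the last block can be incomplete: every block-and-place pair up to that of an existing
vertex is realized. -/
lemma exists_blk_idx (hk : 0 < k) (x : Fin n) {q r : ℕ} (hr : r < 2 * k)
    (h : q < blk k x ∨ q = blk k x ∧ r ≤ idx k x) :
    ∃ y : Fin n, blk k y = q ∧ idx k y = r ∧ y ≤ x := by
  have hle : 2 * k * q + r ≤ x := by
    rw [val_eq k x]
    rcases h with h | ⟨h, h'⟩
    · have := Nat.mul_le_mul_left (2 * k) (Nat.succ_le_of_lt h)
      rw [Nat.mul_succ] at this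
      omega
    · rw [h]; omega
  refine ⟨⟨2 * k * q + r, hle.trans_lt x.2⟩, ?_, ?_, hle⟩
  · change (2 * k * q + r) / (2 * k) = q
    rw [Nat.mul_add_div (by omega), Nat.div_eq_of_lt hr, add_zero]
  · change (2 * k * q + r) % (2 * k) = r
    rw [Nat.mul_add_mod, Nat.mod_eq_of_lt hr]

lemma val_eq_zero_iff (hk : 0 < k) (x : Fin n) : (x : ℕ) = 0 ↔ blk k x = 0 ∧ idx k x = 0 := by
  rw [val_eq k x]
  simp [hk.ne']

lemma isParent_unique (x y z : Fin n) (h : IsParent k x y) (h' : IsParent k x z) : y = z := by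
  unfold IsParent at h h'
  apply eq_of_blk_idx (k := k) <;> omega

lemma exists_isParent (hk : 0 < k) (x : Fin n) (hx : (x : ℕ) ≠ 0) : ∃ y, IsParent k x y := by
  rw [Ne, val_eq_zero_iff hk] at hx
  have hlt := idx_lt hk x
  by_cases h0 : idx k x = 0
  · obtain ⟨y, h1, h2, -⟩ := exists_blk_idx hk x (q := blk k x - 1) (r := k - 1) (by omega)
      (Or.inl (by omega))
    exact ⟨y, by unfold IsParent; omega⟩
  by_cases h1 : idx k x = k
  · obtain ⟨y, h1, h2, -⟩ := exists_blk_idx hk x (q := blk k x) (r := 0) (by omega)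
      (Or.inr (by omega))
    exact ⟨y, by unfold IsParent; omega⟩
  · obtain ⟨y, h1, h2, -⟩ := exists_blk_idx hk x (q := blk k x) (r := idx k x - 1) (by omega)
      (Or.inr (by omega))
    exact ⟨y, by unfold IsParent; omega⟩

lemma IsParent.lt (hk : 0 < k) {x y : Fin n} (h : IsParent k x y) : y < x := by
  rw [Fin.lt_def, val_eq k x, val_eq k y]
  have hx := idx_lt hk x
  have hy := idx_lt hk y
  rcases h with ⟨h1, h2, h3⟩ | ⟨h1, h2, h3⟩ | ⟨h1, h2, h3, h4⟩
  · rw [← h2, Nat.mul_succ]; omega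
  · rw [h2]; omega
  · rw [h3]; omega

lemma IsParent.adj (hk : 0 < k) {x y : Fin n} (h : IsParent k x y) : (comb k n).Adj x y :=
  (SimpleGraph.fromRel_adj _ _ _).2 ⟨(h.lt hk).ne', Or.inl h⟩

lemma comb_connected (hk : 0 < k) (hn : 0 < n) : (comb k n).Connected := by
  rw [SimpleGraph.connected_iff_exists_forall_reachable]
  refine ⟨⟨0, hn⟩, fun x => ?_⟩
  induction x using WellFoundedLT.induction with
  | ind x ih =>
  by_cases hx : (x : ℕ) = 0
  · have : x = ⟨0, hn⟩ := Fin.ext hx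
    rw [this]
  · obtain ⟨y, hy⟩ := exists_isParent hk x hx
    exact (ih y (hy.lt hk)).trans (hy.adj hk).symm.reachable

lemma comb_ncard_edgeSet_lt (hk : 0 < k) (hn : 0 < n) : (comb k n).edgeSet.ncard < n := by
  have h := ncard_edgeSet_fromRel_le (isParent_unique (n := n) (k := k)) {⟨0, hn⟩}ᶜ
    (fun x y h => by
      rw [Set.mem_compl_iff, Set.mem_singleton_iff]
      rintro rfl
      have := h.lt hk
      rw [Fin.lt_def] at this
      simp at this)
  rw [Set.ncard_compl, Set.ncard_singleton, Nat.card_eq_fintype_card, Fintype.card_fin] at h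
  exact h.trans_lt (by omega)

/-- Each edge joins a vertex to its unique parent and the vertex 0 has no parent, so there are fewer
than `n` edges; connectedness does the rest. -/
lemma comb_isTree (hk : 0 < k) (hn : 0 < n) : (comb k n).IsTree := by
  have hc := comb_connected hk hn
  refine SimpleGraph.isTree_iff_connected_and_card.2 ⟨hc, ?_⟩
  have h1 := hc.card_vert_le_card_edgeSet_add_one
  have h2 := comb_ncard_edgeSet_lt hk hn
  rw [← Nat.card_coe_set_eq] at h2
  rw [Nat.card_eq_fintype_card (α := Fin n), Fintype.card_fin] at h1 ⊢
  omega

lemma combHost_connected (hk : 0 < k) (hn : 0 < n) : (combHost k n).Connected :=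
  (comb_connected hk hn).mono le_sup_left

lemma combHost_ncard_edgeSet_le (hk : 0 < k) (hn : 0 < n) :
    (combHost k n).edgeSet.ncard ≤ 3 * n := by
  have h1 := comb_ncard_edgeSet_lt hk hn
  have h2 := ncard_edgeSet_fromRel_le (R := IsToothChord (n := n) k)
    (fun x y z h h' => by
      unfold IsToothChord at h h'
      apply eq_of_blk_idx (k := k) <;> omega) Set.univ (fun _ _ _ => trivial)
  have h3 := ncard_edgeSet_fromRel_le (R := IsBridgeChord (n := n) k)
    (fun x y z h h' => by
      unfold IsBridgeChord at h h'
      apply eq_of_blk_idx (k := k) <;> omega) Set.univ (fun _ _ _ => trivial)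
  rw [Set.ncard_univ, Nat.card_eq_fintype_card, Fintype.card_fin] at h2 h3
  unfold combHost
  rw [SimpleGraph.edgeSet_sup, SimpleGraph.edgeSet_sup]
  have h4 := Set.ncard_union_le (comb k n).edgeSet
    ((SimpleGraph.fromRel (IsToothChord (n := n) k)).edgeSet ∪
      (SimpleGraph.fromRel (IsBridgeChord (n := n) k)).edgeSet)
  have h5 := Set.ncard_union_le (SimpleGraph.fromRel (IsToothChord (n := n) k)).edgeSet
    (SimpleGraph.fromRel (IsBridgeChord (n := n) k)).edgeSet
  omega

lemma comb_edist_le_one (hk : 0 < k) {x y : Fin n}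
    (h : IsParent k x y ∨ IsParent k y x ∨ (blk k x = blk k y ∧ idx k x = idx k y)) :
    (comb k n).edist x y ≤ 1 := by
  rw [SimpleGraph.edist_le_one_iff_adj_or_eq]
  rcases h with h | h | h
  · exact Or.inl (h.adj hk)
  · exact Or.inl (h.adj hk).symm
  · exact Or.inr (eq_of_blk_idx h.1 h.2)

lemma comb_edist_le_idx (hk : 0 < k) {x y : Fin n} (hb : blk k y = blk k x) (hy : idx k y = 0) :
    (comb k n).edist x y ≤ idx k x := by
  induction h : idx k x using Nat.strong_induction_on generalizing x with
  | _ m ih =>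
  rcases Nat.eq_zero_or_pos m with rfl | hm
  · rw [eq_of_blk_idx hb (hy.trans h.symm)]
    simp
  · obtain ⟨p, hp⟩ := exists_isParent hk x (by rw [Ne, val_eq_zero_iff hk]; omega)
    have hp' := hp
    unfold IsParent at hp'
    have h1 := ih (idx k p) (by omega) (x := p) (by omega) rfl
    calc (comb k n).edist x y ≤ (comb k n).edist x p + (comb k n).edist p y :=
          SimpleGraph.edist_triangle
      _ ≤ 1 + idx k p := add_le_add (comb_edist_le_one hk (Or.inl hp)) h1
      _ ≤ (m : ℕ∞) := by
          have : 1 + idx k p ≤ m := by omega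
          exact_mod_cast this

lemma comb_edist_block (hk : 0 < k) {x y : Fin n} (hb : blk k y = blk k x) :
    (comb k n).edist x y ≤ (idx k x + idx k y : ℕ) := by
  obtain ⟨z, hz1, hz2, -⟩ := exists_blk_idx hk x (q := blk k x) (r := 0) (by omega)
    (Or.inr ⟨rfl, Nat.zero_le _⟩)
  push_cast
  refine (SimpleGraph.edist_triangle (v := z)).trans
    (add_le_add (comb_edist_le_idx hk hz1 hz2) ?_)
  rw [SimpleGraph.edist_comm]
  exact comb_edist_le_idx hk (hz1.trans hb.symm) hz2

lemma comb_edist_next_block (hk : 0 < k) {x y : Fin n} (hb : blk k y = blk k x + 1)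
    (hy : idx k y = 0) : (comb k n).edist x y ≤ (idx k x + k : ℕ) := by
  obtain ⟨z, hz⟩ := exists_isParent hk y (by rw [Ne, val_eq_zero_iff hk]; omega)
  have hz' := hz
  unfold IsParent at hz'
  calc (comb k n).edist x y ≤ (comb k n).edist x z + (comb k n).edist z y :=
        SimpleGraph.edist_triangle
    _ ≤ (idx k x + idx k z : ℕ) + 1 := add_le_add (comb_edist_block hk (by omega))
        (comb_edist_le_one hk (Or.inr (Or.inl hz)))
    _ ≤ _ := by
        have : idx k x + idx k z + 1 ≤ idx k x + k := by omega
        exact_mod_cast this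

/-! ### The gain from a single chord. -/

/-- The tooth of block `q`. -/
def tooth (k n q : ℕ) : Finset (Fin n) := {x | blk k x = q ∧ k ≤ idx k x}

lemma card_tooth_le (hk : 0 < k) (q : ℕ) : (tooth k n q).card ≤ k := by
  have := Finset.card_le_card_of_injOn (s := tooth k n q) (t := Finset.Ico k (2 * k)) (idx k)
    (fun x hx => by
      have := idx_lt hk x
      simp only [tooth, Finset.coe_filter, Finset.mem_univ, true_and, Set.mem_ofPred_eq] at hx
      simp only [Finset.coe_Ico, Set.mem_Ico]
      omega)
    (fun x hx y hy h => by
      simp only [tooth, Finset.coe_filter, Finset.mem_univ, true_and, Set.mem_ofPred_eq] at hx hy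
      exact eq_of_blk_idx (hx.1.trans hy.1.symm) h)
  rw [Nat.card_Ico] at this
  omega

lemma distSum_comb_le_of_fold (hk : 0 < k) {u w : Fin n} (q : ℕ) (φ : Fin n → Fin n)
    (hpar : ∀ x y, IsParent k x y → (comb k n).edist (φ x) (φ y) ≤ 1)
    (huw : (comb k n).edist (φ u) (φ w) ≤ 1)
    (hfix : ∀ x ∉ tooth k n q, φ x = x) (hmove : ∀ x, (comb k n).edist x (φ x) ≤ (4 * k : ℕ)) :
    distSum (comb k n) ≤
      distSum (comb k n ⊔ SimpleGraph.edge u w) + ((8 * n * k ^ 2 : ℕ) : ℝ≥0∞) := by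
  refine (distSum_le_of_fold φ (tooth k n q) (4 * k) ?_ hfix hmove).trans
    (add_le_add le_rfl ?_)
  · intro x y h
    rw [SimpleGraph.sup_adj, SimpleGraph.edge_adj] at h
    rcases h with h | ⟨⟨rfl, rfl⟩ | ⟨rfl, rfl⟩, -⟩
    · rcases ((SimpleGraph.fromRel_adj _ _ _).1 h).2 with h | h
      · exact hpar x y h
      · rw [SimpleGraph.edist_comm]; exact hpar y x h
    · exact huw
    · rw [SimpleGraph.edist_comm]; exact huw
  · rw [Fintype.card_fin, Nat.cast_le]
    calc 2 * n * (tooth k n q).card * (4 * k) ≤ 2 * n * k * (4 * k) := by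
          gcongr; exact card_tooth_le hk q
      _ = 8 * n * k ^ 2 := by ring

/-- The fold collapses the whole tooth to its branching vertex, which is also the other end of the
chord. -/
lemma distSum_comb_le_toothChord (hk : 0 < k) {u w : Fin n} (h : IsToothChord k u w) :
    distSum (comb k n) ≤
      distSum (comb k n ⊔ SimpleGraph.edge u w) + ((8 * n * k ^ 2 : ℕ) : ℝ≥0∞) := by
  unfold IsToothChord at h
  have hex : ∀ x : Fin n, ∃ z : Fin n,
      (blk k x = blk k u ∧ k ≤ idx k x ∧ blk k z = blk k x ∧ idx k z = 0) ∨
      (¬ (blk k x = blk k u ∧ k ≤ idx k x) ∧ blk k z = blk k x ∧ idx k z = idx k x) := by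
    intro x
    by_cases hx : blk k x = blk k u ∧ k ≤ idx k x
    · exact ⟨w, Or.inl (by omega)⟩
    · exact ⟨x, Or.inr ⟨hx, rfl, rfl⟩⟩
  choose φ hφ using hex
  refine distSum_comb_le_of_fold hk (blk k u) φ ?_ ?_ ?_ ?_
  · intro x y hxy
    have h1 := hφ x
    have h2 := hφ y
    apply comb_edist_le_one hk
    unfold IsParent at hxy ⊢
    rcases h1 with h1 | h1 <;> rcases h2 with h2 | h2 <;> rcases hxy with h | h | h <;> omega
  · have h1 := hφ u
    have h2 := hφ w
    apply comb_edist_le_one hk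
    right; right
    omega
  · intro x hx
    have h1 := hφ x
    simp only [tooth, Finset.mem_filter, Finset.mem_univ, true_and] at hx
    apply eq_of_blk_idx (k := k) <;> omega
  · intro x
    have h1 := hφ x
    have h2 := idx_lt hk x
    refine (comb_edist_block hk (by omega)).trans (Nat.cast_le.2 ?_)
    omega

set_option maxHeartbeats 1000000 in
-- The fold lays the tooth along the parallel piece of the spine: place `k + r` goes to place `r +
-- 1`, and the tip goes to the first vertex of the next block, the other end of the chord.
lemma distSum_comb_le_bridgeChord (hk : 0 < k) {u w : Fin n} (h : IsBridgeChord k u w) :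
    distSum (comb k n) ≤
      distSum (comb k n ⊔ SimpleGraph.edge u w) + ((8 * n * k ^ 2 : ℕ) : ℝ≥0∞) := by
  unfold IsBridgeChord at h
  have hex : ∀ x : Fin n, ∃ z : Fin n,
      (blk k x = blk k u ∧ k ≤ idx k x ∧ idx k x + 1 < 2 * k ∧ blk k z = blk k x ∧
        idx k z + k = idx k x + 1) ∨
      (blk k x = blk k u ∧ idx k x + 1 = 2 * k ∧ blk k z = blk k x + 1 ∧ idx k z = 0) ∨
      (¬ (blk k x = blk k u ∧ k ≤ idx k x) ∧ blk k z = blk k x ∧ idx k z = idx k x) := by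
    intro x
    have hlt := idx_lt hk x
    by_cases hx : blk k x = blk k u ∧ k ≤ idx k x
    · by_cases hx' : idx k x + 1 = 2 * k
      · exact ⟨w, Or.inr (Or.inl (by omega))⟩
      · obtain ⟨z, hz1, hz2, -⟩ := exists_blk_idx hk x (q := blk k x) (r := idx k x + 1 - k)
          (by omega) (Or.inr (by omega))
        exact ⟨z, Or.inl (by omega)⟩
    · exact ⟨x, Or.inr (Or.inr ⟨hx, rfl, rfl⟩)⟩
  choose φ hφ using hex
  refine distSum_comb_le_of_fold hk (blk k u) φ ?_ ?_ ?_ ?_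
  · intro x y hxy
    have h1 := hφ x
    have h2 := hφ y
    have hx := idx_lt hk x
    have hy := idx_lt hk y
    apply comb_edist_le_one hk
    unfold IsParent at hxy ⊢
    rcases h1 with h1 | h1 | h1 <;> rcases h2 with h2 | h2 | h2
      <;> rcases hxy with h | h | h <;> omega
  · have h1 := hφ u
    have h2 := hφ w
    apply comb_edist_le_one hk
    right; right
    omega
  · intro x hx
    have h1 := hφ x
    simp only [tooth, Finset.mem_filter, Finset.mem_univ, true_and] at hx
    apply eq_of_blk_idx (k := k) <;> omega
  · intro x
    have h1 := hφ x
    have h2 := idx_lt hk x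
    by_cases hb : blk k (φ x) = blk k x
    · refine (comb_edist_block hk hb).trans (Nat.cast_le.2 ?_)
      omega
    · refine (comb_edist_next_block hk (by omega) (by omega)).trans (Nat.cast_le.2 ?_)
      omega

/-- One additional host edge hardly reduces the distances of the comb. -/
lemma distSum_comb_le (hk : 0 < k) {x y : Fin n} (h : (combHost k n).Adj x y)
    (h' : ¬ (comb k n).Adj x y) :
    distSum (comb k n) ≤
      distSum (comb k n ⊔ SimpleGraph.edge x y) + ((8 * n * k ^ 2 : ℕ) : ℝ≥0∞) := by
  simp only [combHost, SimpleGraph.sup_adj, SimpleGraph.fromRel_adj] at h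
  rcases h with h | ⟨-, h | h⟩ | ⟨-, h | h⟩
  · exact absurd h h'
  · exact distSum_comb_le_toothChord hk h
  · rw [SimpleGraph.edge_comm]; exact distSum_comb_le_toothChord hk h
  · exact distSum_comb_le_bridgeChord hk h
  · rw [SimpleGraph.edge_comm]; exact distSum_comb_le_bridgeChord hk h

/-! ### Distance sums of the comb and of the host graph. -/

/-- The position of the projection of `x` to the spine of the comb. -/
def spinePos (k : ℕ) (x : Fin n) : ℕ := k * blk k x + if idx k x < k then idx k x else 0

/-- Projection to the spine is 1-Lipschitz. -/
lemma spinePos_sub_le_edist (hk : 0 < k) (x y : Fin n) :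
    ((spinePos k x - spinePos k y : ℕ) : ℕ∞) ≤ (comb k n).edist x y := by
  -- Truncated subtraction makes this `D` asymmetric, but symmetry is not required.
  refine le_edist_of_adj_le_one (D := fun x y => ((spinePos k x - spinePos k y : ℕ) : ℕ∞))
    (fun x => by simp) (fun x y z => ?_) (fun x y h => ?_) x y
  · have : spinePos k x - spinePos k z ≤
      (spinePos k x - spinePos k y) + (spinePos k y - spinePos k z) := by omega
    exact_mod_cast this
  · have key : ∀ a b : Fin n, IsParent k a b →
        spinePos k a ≤ spinePos k b + 1 ∧ spinePos k b ≤ spinePos k a + 1 := by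
      intro a b h
      unfold spinePos
      rcases h with ⟨h1, h2, h3⟩ | ⟨h1, h2, h3⟩ | ⟨h1, h2, h3, h4⟩
      · rw [← h2, Nat.mul_succ]; split_ifs <;> omega
      · rw [h2]; split_ifs <;> omega
      · rw [h3]; split_ifs <;> omega
    have : spinePos k x - spinePos k y ≤ 1 := by
      rcases ((SimpleGraph.fromRel_adj _ _ _).1 h).2 with h | h
      · have := key x y h; omega
      · have := key y x h; omega
    exact_mod_cast this

/-- Half of each block lies on the spine, so spine position is about half the vertex number.
Vertices in the first and last quarters are therefore at distance at least `n / 8`. -/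
lemma le_distSum_comb (hk : 0 < k) (hn : 144 * k ≤ n) :
    ((n ^ 3 : ℕ) : ℝ≥0∞) ≤ 200 * distSum (comb k n) := by
  set a : Fin n := ⟨n / 4, by omega⟩
  set b : Fin n := ⟨n - n / 4, by omega⟩
  have h1 : ∀ x ∈ Finset.Iio a, ∀ y ∈ Finset.Ici b,
      (n : ℝ≥0∞) ≤ 8 * (((comb k n).edist x y : ℕ∞) : ℝ≥0∞) := by
    intro x hx y hy
    rw [Finset.mem_Iio, Fin.lt_def] at hx
    rw [Finset.mem_Ici, Fin.le_def] at hy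
    change (x : ℕ) < n / 4 at hx
    change n - n / 4 ≤ (y : ℕ) at hy
    have hx1 : 2 * spinePos k x ≤ x + k := by
      rw [val_eq k x]
      unfold spinePos
      rw [Nat.mul_add, ← Nat.mul_assoc]
      split_ifs <;> omega
    have hy1 : (y : ℕ) ≤ 2 * spinePos k y + 2 * k := by
      have := idx_lt hk y
      rw [val_eq k y]
      unfold spinePos
      rw [Nat.mul_add, ← Nat.mul_assoc]
      omega
    have h2 : n ≤ 8 * (spinePos k y - spinePos k x) := by omega
    have h3 := ENat.toENNReal_le.2 (spinePos_sub_le_edist hk y x)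
    rw [ENat.toENNReal_coe, SimpleGraph.edist_comm] at h3
    calc (n : ℝ≥0∞) ≤ ((8 * (spinePos k y - spinePos k x) : ℕ) : ℝ≥0∞) := Nat.cast_le.2 h2
      _ = 8 * ((spinePos k y - spinePos k x : ℕ) : ℝ≥0∞) := by rw [Nat.cast_mul]; rfl
      _ ≤ _ := by gcongr
  have h2 : (((n / 4) * ((n / 4) * n) : ℕ) : ℝ≥0∞) ≤ 8 * distSum (comb k n) := by
    calc (((n / 4) * ((n / 4) * n) : ℕ) : ℝ≥0∞)
        = ∑ x ∈ Finset.Iio a, ∑ y ∈ Finset.Ici b, (n : ℝ≥0∞) := by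
          have hb : n - (n - n / 4) = n / 4 := by omega
          simp [a, b, Fin.card_Iio, Fin.card_Ici, hb]
      _ ≤ ∑ x ∈ Finset.Iio a, ∑ y ∈ Finset.Ici b,
            8 * (((comb k n).edist x y : ℕ∞) : ℝ≥0∞) :=
          Finset.sum_le_sum fun x hx => Finset.sum_le_sum fun y hy => h1 x hx y hy
      _ ≤ ∑ x, ∑ y, 8 * (((comb k n).edist x y : ℕ∞) : ℝ≥0∞) :=
          (Finset.sum_le_sum fun x _ => Finset.sum_le_sum_of_subset (Finset.subset_univ _)).trans
            (Finset.sum_le_sum_of_subset (Finset.subset_univ _))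
      _ = 8 * distSum (comb k n) := by simp only [distSum, Finset.mul_sum]
  have h3 : n ^ 3 ≤ 25 * ((n / 4) * ((n / 4) * n)) := by
    have h5 : n ≤ 5 * (n / 4) := by omega
    calc n ^ 3 = n * n * n := by ring
      _ ≤ (5 * (n / 4)) * (5 * (n / 4)) * n := by gcongr
      _ = _ := by ring
  calc ((n ^ 3 : ℕ) : ℝ≥0∞) ≤ ((25 * ((n / 4) * ((n / 4) * n)) : ℕ) : ℝ≥0∞) := Nat.cast_le.2 h3
    _ = 25 * (((n / 4) * ((n / 4) * n) : ℕ) : ℝ≥0∞) := by rw [Nat.cast_mul]; rfl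
    _ ≤ 25 * (8 * distSum (comb k n)) := by gcongr
    _ = 200 * distSum (comb k n) := by rw [← mul_assoc]; norm_num

/-- From `x` go to the first vertex of its block inside the comb, then back two chords per block
through the tips of the teeth. -/
lemma combHost_edist_le (hk : 0 < k) (x z : Fin n) (hz : (z : ℕ) = 0) :
    (combHost k n).edist x z ≤ (2 * k + 2 * blk k x : ℕ) := by
  have hz' := (val_eq_zero_iff hk z).1 hz
  have hle : ∀ a b : Fin n, (combHost k n).edist a b ≤ (comb k n).edist a b :=
    fun a b => SimpleGraph.edist_anti le_sup_left
  have hbase : ∀ m, ∀ y : Fin n, blk k y = m → idx k y = 0 →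
      (combHost k n).edist y z ≤ (2 * m : ℕ) := by
    intro m
    induction m with
    | zero =>
      intro y hy hy'
      have : y = z := eq_of_blk_idx (k := k) (by omega) (by omega)
      simp [this]
    | succ m ih =>
      intro y hy hy'
      obtain ⟨u, hu1, hu2, -⟩ := exists_blk_idx hk y (q := m) (r := 2 * k - 1) (by omega)
        (Or.inl (by omega))
      obtain ⟨w, hw1, hw2, -⟩ := exists_blk_idx hk y (q := m) (r := 0) (by omega)
        (Or.inl (by omega))
      have h1 : (combHost k n).edist y u ≤ 1 := by
        rw [SimpleGraph.edist_le_one_iff_adj_or_eq]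
        refine Or.inl (Or.inr (Or.inr ((SimpleGraph.fromRel_adj _ _ _).2 ⟨?_, Or.inr ?_⟩)))
        · rintro rfl; omega
        · unfold IsBridgeChord; omega
      have h2 : (combHost k n).edist u w ≤ 1 := by
        rw [SimpleGraph.edist_le_one_iff_adj_or_eq]
        refine Or.inl (Or.inr (Or.inl ((SimpleGraph.fromRel_adj _ _ _).2 ⟨?_, Or.inl ?_⟩)))
        · rintro rfl; omega
        · unfold IsToothChord; omega
      calc (combHost k n).edist y z
          ≤ (combHost k n).edist y u +
              ((combHost k n).edist u w + (combHost k n).edist w z) :=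
            SimpleGraph.edist_triangle.trans (add_le_add le_rfl SimpleGraph.edist_triangle)
        _ ≤ 1 + (1 + (2 * m : ℕ)) := add_le_add h1 (add_le_add h2 (ih w hw1 hw2))
        _ = ((2 * (m + 1) : ℕ) : ℕ∞) := by push_cast; ring
  obtain ⟨w, hw1, hw2, -⟩ := exists_blk_idx hk x (q := blk k x) (r := 0) (by omega)
    (Or.inr ⟨rfl, Nat.zero_le _⟩)
  have hlt := idx_lt hk x
  calc (combHost k n).edist x z
      ≤ (combHost k n).edist x w + (combHost k n).edist w z := SimpleGraph.edist_triangle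
    _ ≤ (idx k x : ℕ∞) + (2 * blk k x : ℕ) :=
        add_le_add ((hle x w).trans (comb_edist_le_idx hk hw1 hw2)) (hbase _ w hw1 hw2)
    _ ≤ _ := by
        have : idx k x + 2 * blk k x ≤ 2 * k + 2 * blk k x := by omega
        exact_mod_cast this

/-- Up to constants a distance is at most `k + n / k`, and `4 * k ^ 2 ≤ n` makes the second term
dominate. -/
lemma distSum_combHost_le (hk : 0 < k) (hn : 4 * k ^ 2 ≤ n) :
    k * distSum (combHost k n) ≤ ((3 * n ^ 3 : ℕ) : ℝ≥0∞) := by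
  have hn0 : 0 < n := lt_of_lt_of_le (by positivity) hn
  have h1 : ∀ x y : Fin n, k * (((combHost k n).edist x y : ℕ∞) : ℝ≥0∞) ≤ ((3 * n : ℕ) : ℝ≥0∞) := by
    intro x y
    have hx := combHost_edist_le hk x ⟨0, hn0⟩ rfl
    have hy := combHost_edist_le hk y ⟨0, hn0⟩ rfl
    rw [SimpleGraph.edist_comm] at hy
    have hxy := ENat.toENNReal_le.2
      ((SimpleGraph.edist_triangle (G := combHost k n)).trans (add_le_add hx hy))
    rw [← Nat.cast_add, ENat.toENNReal_coe] at hxy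
    have hb : ∀ v : Fin n, 2 * k * blk k v ≤ n := fun v => by
      have := val_eq k v
      have := v.2
      omega
    calc k * (((combHost k n).edist x y : ℕ∞) : ℝ≥0∞)
        ≤ k * ((2 * k + 2 * blk k x + (2 * k + 2 * blk k y) : ℕ) : ℝ≥0∞) := by gcongr
      _ = ((4 * k ^ 2 + (2 * k * blk k x + 2 * k * blk k y) : ℕ) : ℝ≥0∞) := by push_cast; ring
      _ ≤ ((3 * n : ℕ) : ℝ≥0∞) := by
        rw [Nat.cast_le]
        have := hb x
        have := hb y
        omega
  calc k * distSum (combHost k n)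
      = ∑ x, ∑ y, k * (((combHost k n).edist x y : ℕ∞) : ℝ≥0∞) := by
        simp only [distSum, Finset.mul_sum]
    _ ≤ ∑ x : Fin n, ∑ y : Fin n, ((3 * n : ℕ) : ℝ≥0∞) :=
        Finset.sum_le_sum fun x _ => Finset.sum_le_sum fun y _ => h1 x y
    _ = _ := by
        simp only [Finset.sum_const, Finset.card_univ, Fintype.card_fin, nsmul_eq_mul]
        push_cast
        ring

end Comb

/-! ### Bounds for the price of anarchy. -/

section PriceOfAnarchy

variable {V : Type*} [Fintype V] {G T : SimpleGraph V} {α : ℝ≥0}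

/-- The competitor is the strategy that builds all of `G`. -/
lemma iInf_totalCost_le [Nonempty V] (hα : 0 < α) :
    ⨅ s : JointStrategy G, totalCost α s ≤ α * (G.edgeSet.ncard : ℝ≥0∞) + distSum G := by
  classical
  refine (iInf_le _ (evenOffers G G α)).trans ?_
  have hcard : (builtEdges α (evenOffers G G α)).card = G.edgeSet.ncard := by
    have h : builtEdges α (evenOffers G G α) = Finset.univ := by
      ext e
      simp [mem_builtEdges_evenOffers hα]
    rw [h, Finset.card_univ, ← Nat.card_coe_set_eq, Nat.card_eq_fintype_card]
  rw [totalCost_eq, network_evenOffers hα le_rfl, hcard]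

lemma distSum_ne_zero [Nontrivial V] (H : SimpleGraph V) : distSum H ≠ 0 := by
  obtain ⟨x, y, hxy⟩ := exists_pair_ne V
  intro h
  simp only [distSum, Finset.sum_eq_zero_iff, Finset.mem_univ, true_imp_iff,
    ENat.toENNReal_eq_zero, SimpleGraph.edist_eq_zero_iff] at h
  exact hxy (h x y)

lemma distSum_ne_top {H : SimpleGraph V} (hH : H.Connected) : distSum H ≠ ⊤ := by
  simp [distSum, ENNReal.sum_eq_top, SimpleGraph.edist_ne_top_iff_reachable.2 (hH _ _)]

lemma totalCost_evenOffers_ne_top [Nonempty V] (hα : 0 < α) (hTG : T ≤ G) (hT : T.Connected) :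
    totalCost α (evenOffers G T α) ≠ ⊤ := by
  rw [totalCost_eq, network_evenOffers hα hTG]
  exact ENNReal.add_ne_top.2 ⟨ENNReal.mul_ne_top ENNReal.coe_ne_top (ENNReal.natCast_ne_top _),
    distSum_ne_top hT⟩

/-- An equilibrium of large cost makes the price of anarchy large. -/
lemma le_priceOfAnarchy [Nontrivial V] {s : JointStrategy G}
    (hs : IsCollaborativeEquilibrium α s) (hfin : totalCost α s ≠ ⊤) {m : ℝ≥0∞}
    (h : m * ⨅ t : JointStrategy G, totalCost α t ≤ totalCost α s) :
    m ≤ priceOfAnarchy α G := by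
  have hle : totalCost α s ≤
      ⨆ (t : JointStrategy G) (_ : IsCollaborativeEquilibrium α t), totalCost α t :=
    le_iSup₂ (f := fun (t : JointStrategy G) (_ : IsCollaborativeEquilibrium α t) =>
      totalCost α t) s hs
  have hpos : ∀ t : JointStrategy G, totalCost α t ≠ 0 := fun t ht => by
    rw [totalCost_eq, add_eq_zero] at ht
    exact distSum_ne_zero _ ht.2
  unfold priceOfAnarchy
  -- In `ℝ≥0∞` both `0 / 0` and `⊤ / ⊤` are `0`, so these cases have to be excluded.
  rw [ENNReal.le_div_iff_mul_le]
  · exact h.trans hle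
  · refine Or.inr fun h0 => hpos s ?_
    rw [h0] at hle
    exact le_antisymm hle bot_le
  · exact Or.inl (ne_top_of_le_ne_top hfin (iInf_le _ s))

/-- On a tree the price of anarchy is at least one. -/
lemma one_le_priceOfAnarchy_of_isTree [Nontrivial V] (hα : 0 < α) (hT : T.IsTree) :
    1 ≤ priceOfAnarchy α T := by
  refine le_priceOfAnarchy
    (isCollaborativeEquilibrium_evenOffers hα le_rfl hT fun x y h h' => absurd h h')
    (totalCost_evenOffers_ne_top hα le_rfl hT.1) ?_
  rw [one_mul]
  exact iInf_le _ _

end PriceOfAnarchy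

lemma le_priceOfAnarchy_combHost {n k : ℕ} {α : ℝ≥0} {m : ℝ≥0∞} (hk : 0 < k) (hn : 144 * k ≤ n)
    (hα : 8 * (n : ℝ≥0) * (k : ℝ≥0) ^ 2 < α)
    (hm : m * (α * ((3 * n : ℕ) : ℝ≥0∞) + distSum (combHost k n)) * 200 ≤ ((n ^ 3 : ℕ) : ℝ≥0∞)) :
    m ≤ priceOfAnarchy α (combHost k n) := by
  have hn0 : 0 < n := by omega
  have : Nontrivial (Fin n) := Fin.nontrivial_iff_two_le.2 (by omega)
  have hα0 : 0 < α := bot_le.trans_lt hα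
  have htree := comb_isTree hk hn0
  refine le_priceOfAnarchy
    (isCollaborativeEquilibrium_evenOffers hα0 le_sup_left htree fun x y h h' => ?_)
    (totalCost_evenOffers_ne_top hα0 le_sup_left htree.1) ?_
  · refine (distSum_comb_le hk h h').trans_lt (ENNReal.add_lt_add_left (a := _) ?_ ?_)
    · exact distSum_ne_top (htree.1.mono le_sup_left)
    · rw [← ENNReal.coe_natCast, ENNReal.coe_lt_coe]
      push_cast
      exact hα
  · have h1 : m * (⨅ t : JointStrategy (combHost k n), totalCost α t) * 200 ≤
        distSum (comb k n) * 200 := by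
      calc m * (⨅ t : JointStrategy (combHost k n), totalCost α t) * 200
          ≤ m * (α * ((3 * n : ℕ) : ℝ≥0∞) + distSum (combHost k n)) * 200 := by
            gcongr
            refine (iInf_totalCost_le hα0).trans ?_
            gcongr
            exact combHost_ncard_edgeSet_le hk hn0
        _ ≤ ((n ^ 3 : ℕ) : ℝ≥0∞) := hm
        _ ≤ 200 * distSum (comb k n) := le_distSum_comb hk hn
        _ = _ := mul_comm _ _
    refine ((ENNReal.mul_le_mul_iff_left (by norm_num) (by norm_num)).1 h1).trans ?_
    rw [totalCost_eq, network_evenOffers hα0 le_sup_left]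
    exact le_add_self

end CooperativeGame

/-! ### The choice of the tooth length. -/

theorem mainTheorem9 :
    ∃ c : ℝ, 0 < c ∧
      ∀ n : ℕ, 2 ≤ n → ∀ α : ℝ≥0, 0 < α →
        ∃ G : SimpleGraph (Fin n), G.Connected ∧
          ENNReal.ofReal (c * min (Real.sqrt ((α : ℝ) / (n : ℝ))) ((n : ℝ) ^ 2 / (α : ℝ))) ≤
            CooperativeGame.priceOfAnarchy α G := by
  -- Here `4200 = 200 * (18 + 3)`: 200 from `le_distSum_comb`, 18 and 3 from `hmD` and `hmα` below.
  refine ⟨1 / 4200, by norm_num, fun n hn α hα => ?_⟩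
  have hα' : (0 : ℝ) < α := hα
  have hn' : (2 : ℝ) ≤ n := by exact_mod_cast hn
  set ρ : ℝ := Real.sqrt ((α : ℝ) / (n : ℝ)) with hρ
  have hρ0 : 0 ≤ ρ := Real.sqrt_nonneg _
  have hρ2 : ρ ^ 2 * n = α := by
    rw [hρ, Real.sq_sqrt (by positivity)]
    field_simp
  -- A bounded minimum needs only a price of anarchy of at least one, which any tree host provides.
  by_cases hsmall : min ρ ((n : ℝ) ^ 2 / (α : ℝ)) ≤ 16
  · have : Nontrivial (Fin n) := Fin.nontrivial_iff_two_le.2 hn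
    have htree := CooperativeGame.comb_isTree (k := 1) one_pos (show 0 < n by omega)
    refine ⟨_, htree.1, le_trans ?_
      (CooperativeGame.one_le_priceOfAnarchy_of_isTree hα htree)⟩
    rw [ENNReal.ofReal_le_one]
    linarith
  push Not at hsmall
  obtain ⟨h1, h2⟩ := lt_min_iff.1 hsmall
  rw [lt_div_iff₀ hα'] at h2
  -- The divisor 3 gives `8 * n * k ^ 2 ≤ 8 * α / 9 < α`; since `ρ > 16`, rounding down still leaves
  -- `k ≥ ρ / 6`.
  set k : ℕ := ⌊ρ / 3⌋₊ with hkdef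
  have hk1 : (k : ℝ) ≤ ρ / 3 := Nat.floor_le (by positivity)
  have hk2 : ρ / 3 < k + 1 := Nat.lt_floor_add_one _
  have hkpos : 0 < k := Nat.floor_pos.2 (by linarith)
  have hk3 : ρ / 6 ≤ k := by linarith
  have hρn : 16 * ρ ^ 2 < n := by
    rw [← hρ2] at h2
    nlinarith
  have hkn : 144 * k ^ 2 ≤ n := by
    have : (144 : ℝ) * (k : ℝ) ^ 2 ≤ n := by nlinarith
    exact_mod_cast this
  have hkk : k ≤ k ^ 2 := Nat.le_self_pow two_ne_zero k
  refine ⟨_, CooperativeGame.combHost_connected hkpos (by omega),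
    CooperativeGame.le_priceOfAnarchy_combHost hkpos (by omega) ?_ ?_⟩
  · rw [← NNReal.coe_lt_coe]
    push_cast
    have : (k : ℝ) ^ 2 ≤ (ρ / 3) ^ 2 := by gcongr
    nlinarith
  · set m := min ρ ((n : ℝ) ^ 2 / (α : ℝ)) with hm
    have hm0 : 0 < m := by linarith
    have hD := CooperativeGame.distSum_combHost_le (n := n) hkpos (by omega)
    have hDtop := CooperativeGame.distSum_ne_top
      (CooperativeGame.combHost_connected (n := n) hkpos (by omega))
    lift CooperativeGame.distSum (CooperativeGame.combHost k n) to ℝ≥0 using hDtop with D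
    have hD' : (k : ℝ) * D ≤ 3 * (n : ℝ) ^ 3 := by exact_mod_cast hD
    have hm1 : m ≤ ρ := min_le_left _ _
    have hm2 : m * α ≤ (n : ℝ) ^ 2 := by
      rw [← le_div_iff₀ hα']
      exact min_le_right _ _
    have hD0 : (0 : ℝ) ≤ D := D.2
    -- Uses `m ≤ ρ ≤ 6 * k` together with `k * D ≤ 3 * n ^ 3`.
    have hmD : m * D ≤ 18 * (n : ℝ) ^ 3 := by nlinarith
    have hmα : m * (α * (3 * n)) ≤ 3 * (n : ℝ) ^ 3 := by nlinarith
    have hfin : 1 / 4200 * m * (α * (3 * n) + D) * 200 ≤ (n : ℝ) ^ 3 := by nlinarith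
    have hgoal := ENNReal.ofReal_le_ofReal hfin
    rw [ENNReal.ofReal_mul (by positivity), ENNReal.ofReal_mul (by positivity),
      ENNReal.ofReal_add (by positivity) hD0, ENNReal.ofReal_mul (p := (α : ℝ)) hα'.le] at hgoal
    simpa [ENNReal.ofReal_mul, ENNReal.ofReal_pow] using hgoal
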